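/- Let $V, V_1 \in L^\infty(\mathbb{R})$ be real-valued functions of compact support and let $V_\lambda \in L^\infty(\mathbb{R})$, for small nonzero real $\lambda$, be real-valued functions whose supports lie in a common bounded interval, such that $\|V_\lambda - V - \lambda V_1\|_{L_2(\mathbb{R})} = o(\lambda)$ as $\lambda \to 0$ (through positive and negative values). Suppose that $V$ is not zero almost everywhere, that $$\int_{\mathbb{R}} V\,dx = 0, \qquad\text{and that}\qquad \int_{\mathbb{R}} V_1\,dx = 0$$ (in particular one may take $V_1 = 0$, or $V_\lambda = V$ for all $\lambda$). Then for all sufficiently small nonzero $\lambda$, positive or negative, the operator $H_\lambda = -\frac{d^2}{dx^2} + \lambda V_\lambda$ in $L_2(\mathbb{R})$ with domain $W_2^2(\mathbb{R})$ has an eigenvalue $e_\lambda$ with the asymptotics $$e_\lambda = -\frac{\lambda^4}{16}\left(\iint_{\mathbb{R}^2} V(x)\,|x-y|\,V(y)\,dx\,dy + o(1)\right)^2 \quad\text{as } \lambda \to 0.$$ The same eigenvalue $e_\lambda$ also satisfies $$e_\lambda = -\frac{\lambda^4}{4}\left(\int_{\mathbb{R}}\left(\int_{-\infty}^x V(y)\,dy\right)^2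 dx + o(1)\right)^2 \quad\text{as } \lambda \to 0.$$ -/

import Mathlib

open MeasureTheory Filter Topology Asymptotics
open scoped ContDiff ENNReal

/-- `g` is the weak derivative of `f` on the real line: integration by parts holds against every
smooth compactly supported test function. It is only used for `f` and `g` in `L²(ℝ)`, where both
integrals converge. -/
def IsWeakDeriv (f g : ℝ → ℂ) : Prop :=
  ∀ φ : ℝ → ℝ, ContDiff ℝ ∞ φ → HasCompactSupport φ →
    ∫ x, deriv φ x • f x = -∫ x, φ x • g x

/-- `f` belongs to the Sobolev space `W₂²(ℝ)`, with first and second weak derivatives `f₁`, `f₂`: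
all three functions are in `L²(ℝ)`. -/
structure IsW22With (f f₁ f₂ : ℝ → ℂ) : Prop where
  memLp : MemLp f 2 volume
  memLp_deriv : MemLp f₁ 2 volume
  memLp_deriv2 : MemLp f₂ 2 volume
  weakDeriv : IsWeakDeriv f f₁
  weakDeriv2 : IsWeakDeriv f₁ f₂

/-- The graph of the Schrödinger operator `-d²/dx² + q` in `L²(ℝ; ℂ)` with domain `W₂²(ℝ)`:
`f` lies in the domain, `h` lies in `L²(ℝ)`, and `-f'' + q f = h` almost everywhere. -/
def SchrodingerGraph (q : ℝ → ℝ) (f h : ℝ → ℂ) : Prop :=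
  MemLp h 2 volume ∧
    ∃ f₁ f₂ : ℝ → ℂ, IsW22With f f₁ f₂ ∧ ∀ᵐ x, -f₂ x + (q x : ℂ) * f x = h x

/-- `e` is an eigenvalue of `-d²/dx² + q` with domain `W₂²(ℝ)`: some `ψ` in the domain that is
not zero in `L²(ℝ)` is mapped to `e ψ`. The operator is symmetric for real `q`, so only real `e`
can occur. -/
def IsSchrodingerEigenvalue (q : ℝ → ℝ) (e : ℝ) : Prop :=
  ∃ ψ : ℝ → ℂ, ¬ (ψ =ᵐ[volume] 0) ∧ SchrodingerGraph q ψ (fun x => (e : ℂ) * ψ x)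

/-! ### Perturbation of the shooting equation in Banach spaces -/

section Abstract

variable {H E : Type*} [NormedAddCommGroup H] [NormedSpace ℝ H]
  [NormedAddCommGroup E] [NormedSpace ℝ E]

/-! The proof is a shooting argument with `e = -k²`, `k > 0`. Left of the supports a decaying
solution is `exp (k (x + R))`; inside `[-R, R]` it continues as the solution of `ψ'' = p ψ`, `p = λ
V_λ + k²`, with data `1`, `k` at `-R`, that is, of a Volterra equation. It continues as a decaying
exponential on the right exactly when `ψ'(R) + k ψ(R) = 0`, so eigenvalues come from zeros of `G(λ,
k) = k + ∫ p ψ + k ψ(R)`.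

For `k = O(λ²)` one has `ψ = 1 + λ A V 1 + O(λ²)`, where `A V 1 (x) = ∫_{-R}^x (x - t) V(t) dt`. As
`V` and `V₁` have mean zero, `λ ∫ V_λ = o(λ²)`, whence `G = 2k - J λ² + o(λ²)` with `J = -∫ V (A V
1)` (`mismatch_isLittleO`). Integration by parts gives `J = ∫ (∫_{-∞}^x V)²`, which is positive
since `V ≠ 0`. Thus `G` changes sign on `[0, J λ²]`, and any zero there satisfies `k / λ² → J / 2`
(`exists_mismatch_eq_zero`). The double integral with `|x - y|` equals `-2J`, so both asymptotic
formulas say the same. -/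

/-- The solution `ψ` of `ψ = ψ₀ + T ψ`, provided that `1 - T` is invertible. -/
noncomputable def resolventSolution (T : E →L[ℝ] E) (ψ₀ : E) : E :=
  Ring.inverse (1 - T) ψ₀

theorem resolventSolution_eq {T : E →L[ℝ] E} (hT : IsUnit (1 - T)) (ψ₀ : E) :
    resolventSolution T ψ₀ = ψ₀ + T (resolventSolution T ψ₀) := by
  have h := congrArg (fun S : E →L[ℝ] E => S ψ₀) (Ring.mul_inverse_cancel _ hT)
  simp only [one_apply_eq_self] at h
  rw [resolventSolution]
  exact sub_eq_iff_eq_add.mp h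

/-- The mismatch of the boundary condition at the right end, as a function of `k`. -/
noncomputable def mismatch (A : H →L[ℝ] E →L[ℝ] E) (L : H →L[ℝ] E →L[ℝ] ℝ) (ev : E →L[ℝ] ℝ)
    (e₀ e₁ : E) (u w : H) (lam k : ℝ) : ℝ :=
  k + L (lam • w + k ^ 2 • u) (resolventSolution (A (lam • w + k ^ 2 • u)) (e₀ + k • e₁))
    + k * ev (resolventSolution (A (lam • w + k ^ 2 • u)) (e₀ + k • e₁))

theorem IsBigO.bilin {F α : Type*} [NormedAddCommGroup F] [NormedSpace ℝ F]
    {l : Filter α} (B : H →L[ℝ] E →L[ℝ] F) {f : α → H} {g : α → E} {a b : α → ℝ}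
    (hf : f =O[l] a) (hg : g =O[l] b) : (fun x => B (f x) (g x)) =O[l] fun x => a x * b x := by
  have h : (fun x => B (f x) (g x)) =O[l] fun x => ‖f x‖ * ‖g x‖ :=
    IsBigO.of_bound ‖B‖ (Eventually.of_forall fun x => by
      simpa [mul_assoc] using B.le_opNorm₂ (f x) (g x))
  exact h.trans (hf.norm_left.mul hg.norm_left)

theorem isBigO_one_of_isLittleO_sub {w : ℝ → H} {v v₁ : H}
    (hw : (fun lam => w lam - v - lam • v₁) =o[𝓝[≠] (0 : ℝ)] (fun lam : ℝ => lam)) :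
    (fun lam => w lam - v) =O[𝓝[≠] (0 : ℝ)] (fun lam : ℝ => lam) := by
  have h : (fun lam : ℝ => lam • v₁) =O[𝓝[≠] (0 : ℝ)] (fun lam : ℝ => lam) :=
    IsBigO.of_bound ‖v₁‖ (Eventually.of_forall fun x => by rw [norm_smul, mul_comm])
  refine (hw.isBigO.add h).congr_left fun lam => ?_
  abel

/-- The Neumann series gives `ψ = e₀ + lam • A v e₀ + O(lam²)`. Since `L` kills both `(v, e₀)` and
`(v₁, e₀)`, the leading part of `L p ψ` is the second-order term `lam² L v (A v e₀)`; the two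
remaining terms give `2k` because `ev e₀ = 1`. -/
theorem mismatch_isLittleO [CompleteSpace E] (A : H →L[ℝ] E →L[ℝ] E) (L : H →L[ℝ] E →L[ℝ] ℝ)
    (ev : E →L[ℝ] ℝ) (e₀ e₁ : E) (hev : ev e₀ = 1) (u v v₁ : H) (w : ℝ → H)
    (hw : (fun lam => w lam - v - lam • v₁) =o[𝓝[≠] (0 : ℝ)] (fun lam : ℝ => lam))
    (hv : L v e₀ = 0) (hv₁ : L v₁ e₀ = 0)
    (k : ℝ → ℝ) (hk : k =O[𝓝[≠] (0 : ℝ)] (fun lam : ℝ => lam ^ 2)) :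
    (fun lam => mismatch A L ev e₀ e₁ u (w lam) lam (k lam) - 2 * k lam
      - lam ^ 2 * L v (A v e₀)) =o[𝓝[≠] (0 : ℝ)] (fun lam : ℝ => lam ^ 2) := by
  set l := 𝓝[≠] (0 : ℝ) with hl
  have hid : Tendsto (fun lam : ℝ => lam) l (𝓝 0) := tendsto_id.mono_left nhdsWithin_le_nhds
  have hpow : ∀ {m n : ℕ}, m < n → (fun lam : ℝ => lam ^ n) =o[l] (fun lam : ℝ => lam ^ m) :=
    fun h => (isLittleO_pow_pow h).mono nhdsWithin_le_nhds
  have hpow' : ∀ {m n : ℕ}, m ≤ n → (fun lam : ℝ => lam ^ n) =O[l] (fun lam : ℝ => lam ^ m) := by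
    intro m n h
    rcases h.lt_or_eq with h | rfl
    · exact (hpow h).isBigO
    · exact isBigO_refl _ _
  set p : ℝ → H := fun lam => lam • w lam + (k lam) ^ 2 • u with hp
  set ψ : ℝ → E := fun lam => resolventSolution (A (p lam)) (e₀ + k lam • e₁) with hψ
  have hwv := isBigO_one_of_isLittleO_sub hw
  have hk2 : (fun lam => (k lam) ^ 2) =O[l] (fun lam : ℝ => lam ^ 4) := by
    simpa [← pow_mul] using hk.pow 2
  have hk2u : (fun lam => (k lam) ^ 2 • u) =O[l] (fun lam : ℝ => lam ^ 4) := by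
    simpa using hk2.smul (isBigO_const_const u (one_ne_zero (α := ℝ)) l)
  have hpv : (fun lam => p lam - lam • v) =O[l] (fun lam : ℝ => lam ^ 2) := by
    have h1 : (fun lam : ℝ => lam • (w lam - v)) =O[l] (fun lam : ℝ => lam ^ 2) := by
      simpa [sq] using (isBigO_refl (fun lam : ℝ => lam) l).smul hwv
    refine (h1.add (hk2u.trans (hpow' (by norm_num)))).congr_left fun lam => ?_
    simp only [hp, smul_sub]; abel
  have hlv : ∀ z : H, (fun lam : ℝ => lam • z) =O[l] (fun lam : ℝ => lam) := fun z =>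
    IsBigO.of_bound ‖z‖ (Eventually.of_forall fun x => by rw [norm_smul, mul_comm])
  have hp1 : p =O[l] (fun lam : ℝ => lam) := by
    have h2 : (fun lam : ℝ => lam ^ 2) =O[l] (fun lam : ℝ => lam) := by
      simpa using hpow' (m := 1) (n := 2) (by norm_num)
    refine ((hpv.trans h2).add (hlv v)).congr_left fun lam => ?_
    abel
  have hT : Tendsto (fun lam => A (p lam)) l (𝓝 0) := by
    have : Tendsto p l (𝓝 0) := hp1.trans_tendsto hid
    exact (A.continuous.tendsto' 0 0 (map_zero A)).comp this
  have hunit : ∀ᶠ lam in l, ψ lam = (e₀ + k lam • e₁) + A (p lam) (ψ lam) := by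
    have h1 : ∀ᶠ lam in l, ‖A (p lam)‖ < 1 := by
      have := hT.norm
      rw [norm_zero] at this
      exact this.eventually (gt_mem_nhds one_pos)
    filter_upwards [h1] with lam h
    exact resolventSolution_eq (Units.oneSub _ h).isUnit _
  have hke : (fun lam => k lam • e₁) =O[l] (fun lam : ℝ => lam ^ 2) := by
    simpa using hk.smul (isBigO_const_const e₁ (one_ne_zero (α := ℝ)) l)
  have hψO : ψ =O[l] (fun _ => (1 : ℝ)) := by
    have h1 : (fun lam => Ring.inverse (1 - A (p lam))) =O[l] (fun _ => (1 : ℝ)) :=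
      (NormedRing.inverse_one_sub_norm (R := E →L[ℝ] E)).comp_tendsto hT
    have h2 : (fun lam => e₀ + k lam • e₁) =O[l] (fun _ => (1 : ℝ)) :=
      (isBigO_const_const e₀ (one_ne_zero (α := ℝ)) l).add
        (hke.trans (by simpa using hpow' (m := 0) (n := 2) (by norm_num)))
    exact (IsBigO.bilin (ContinuousLinearMap.id ℝ (E →L[ℝ] E)) h1 h2).congr_right fun _ => mul_one 1
  have hψ1 : (fun lam => ψ lam - e₀) =O[l] (fun lam : ℝ => lam) := by
    have h1 : (fun lam => A (p lam) (ψ lam)) =O[l] (fun lam : ℝ => lam) := by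
      simpa using IsBigO.bilin A hp1 hψO
    have h2 : (fun lam => k lam • e₁) =O[l] (fun lam : ℝ => lam) :=
      hke.trans (by simpa using hpow' (m := 1) (n := 2) (by norm_num))
    refine (h2.add h1).congr' ?_ EventuallyEq.rfl
    filter_upwards [hunit] with lam h
    nth_rewrite 2 [h]; abel
  have hψ2 : (fun lam => ψ lam - e₀ - lam • A v e₀) =O[l] (fun lam : ℝ => lam ^ 2) := by
    have h1 : (fun lam => A (p lam) (ψ lam - e₀)) =O[l] (fun lam : ℝ => lam ^ 2) := by
      simpa [sq] using IsBigO.bilin A hp1 hψ1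
    have h2 : (fun lam => A (p lam - lam • v) e₀) =O[l] (fun lam : ℝ => lam ^ 2) := by
      simpa using IsBigO.bilin A hpv (isBigO_const_const e₀ (one_ne_zero (α := ℝ)) l)
    refine ((hke.add h1).add h2).congr' ?_ EventuallyEq.rfl
    filter_upwards [hunit] with lam h
    nth_rewrite 2 [h]
    simp only [map_sub, map_smul, sub_apply, smul_apply]
    abel
  -- Only here is the full expansion of `w` needed; elsewhere `w - v = O(lam)` suffices.
  have hA : (fun lam => L (p lam) e₀) =o[l] (fun lam : ℝ => lam ^ 2) := by
    have h1 : (fun lam => L (w lam - v - lam • v₁) e₀) =o[l] (fun lam : ℝ => lam) := by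
      have : (fun lam => (L.flip e₀) (w lam - v - lam • v₁)) =O[l]
          (fun lam => w lam - v - lam • v₁) := (L.flip e₀).isBigO_comp _ _
      exact this.trans_isLittleO hw
    have h2 : (fun lam => lam * L (w lam - v - lam • v₁) e₀) =o[l] (fun lam : ℝ => lam ^ 2) := by
      simpa [sq] using (isBigO_refl (fun lam : ℝ => lam) l).mul_isLittleO h1
    have h3 : (fun lam => (k lam) ^ 2 * L u e₀) =o[l] (fun lam : ℝ => lam ^ 2) := by
      have : (fun lam => (k lam) ^ 2 * L u e₀) =O[l] (fun lam : ℝ => lam ^ 4) := by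
        simpa using hk2.mul (isBigO_const_const (L u e₀) (one_ne_zero (α := ℝ)) l)
      exact this.trans_isLittleO (hpow (by norm_num))
    refine (h2.add h3).congr_left fun lam => ?_
    simp [hp, hv, hv₁]
  have hB : (fun lam => L (p lam) (ψ lam - e₀ - lam • A v e₀)) =o[l] (fun lam : ℝ => lam ^ 2) := by
    have h1 : (fun lam => L (p lam) (ψ lam - e₀ - lam • A v e₀)) =O[l] (fun lam : ℝ => lam ^ 3) := by
      refine (IsBigO.bilin L hp1 hψ2).congr_right fun lam => by ring
    exact h1.trans_isLittleO (hpow (by norm_num))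
  have hC : (fun lam => L (p lam - lam • v) (lam • A v e₀)) =o[l] (fun lam : ℝ => lam ^ 2) := by
    have h0 : (fun lam : ℝ => lam • A v e₀) =O[l] (fun lam : ℝ => lam) :=
      IsBigO.of_bound ‖A v e₀‖ (Eventually.of_forall fun x => by rw [norm_smul, mul_comm])
    have h1 : (fun lam => L (p lam - lam • v) (lam • A v e₀)) =O[l] (fun lam : ℝ => lam ^ 3) :=
      (IsBigO.bilin L hpv h0).congr_right fun lam => by ring
    exact h1.trans_isLittleO (hpow (by norm_num))
  have hD : (fun lam => k lam * ev (ψ lam - e₀)) =o[l] (fun lam : ℝ => lam ^ 2) := by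
    have h1 : (fun lam => k lam * ev (ψ lam - e₀)) =O[l] (fun lam : ℝ => lam ^ 3) :=
      (hk.mul ((ev.isBigO_comp _ _).trans hψ1)).congr_right fun lam => by ring
    exact h1.trans_isLittleO (hpow (by norm_num))
  -- Bilinearity splits `L p ψ` into `L p e₀`, `L p (ψ - e₀ - lam • A v e₀)`, `L (p - lam • v) (lam
  -- • A v e₀)` and the main term `lam² L v (A v e₀)`.
  refine (((hA.add hB).add hC).add hD).congr_left fun lam => ?_
  have hG : mismatch A L ev e₀ e₁ u (w lam) lam (k lam)
      = k lam + L (p lam) (ψ lam) + k lam * ev (ψ lam) := rfl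
  simp only [hG, map_sub, map_smul, sub_apply, smul_apply, hev, smul_eq_mul]
  ring

/-- Uniformity in `k` makes the Volterra equation solvable on a whole interval of `k` for one fixed
`lam`, as the intermediate value theorem requires. -/
theorem eventually_norm_lt_one (A : H →L[ℝ] E →L[ℝ] E) (u v v₁ : H) (w : ℝ → H)
    (hw : (fun lam => w lam - v - lam • v₁) =o[𝓝[≠] (0 : ℝ)] (fun lam : ℝ => lam)) (C : ℝ) :
    ∀ᶠ lam in 𝓝[≠] (0 : ℝ), ∀ k ∈ Set.Icc 0 (C * lam ^ 2),
      ‖A (lam • w lam + k ^ 2 • u)‖ < 1 := by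
  have hid : Tendsto (fun lam : ℝ => lam) (𝓝[≠] (0 : ℝ)) (𝓝 0) :=
    tendsto_id.mono_left nhdsWithin_le_nhds
  have hw0 : Tendsto w (𝓝[≠] (0 : ℝ)) (𝓝 v) := by
    have h := (isBigO_one_of_isLittleO_sub hw).trans_tendsto hid
    simpa using h.add_const v
  have h : Tendsto (fun lam : ℝ => ‖A‖ * (|lam| * ‖w lam‖ + (C * lam ^ 2) ^ 2 * ‖u‖))
      (𝓝[≠] (0 : ℝ)) (𝓝 (‖A‖ * (|0| * ‖v‖ + (C * 0 ^ 2) ^ 2 * ‖u‖))) :=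
    ((hid.abs.mul hw0.norm).add ((((hid.pow 2).const_mul C).pow 2).mul_const _)).const_mul _
  simp only [abs_zero, zero_mul, ne_eq, OfNat.ofNat_ne_zero, not_false_eq_true, zero_pow, mul_zero,
    add_zero] at h
  filter_upwards [h.eventually (gt_mem_nhds one_pos)] with lam hlam k hk
  refine lt_of_le_of_lt ((A.le_opNorm _).trans ?_) hlam
  gcongr
  refine (norm_add_le _ _).trans ?_
  rw [norm_smul, norm_smul, Real.norm_eq_abs, Real.norm_eq_abs, abs_of_nonneg (sq_nonneg k)]
  have := hk.1
  have := hk.2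
  gcongr

theorem continuousOn_mismatch [CompleteSpace E] (A : H →L[ℝ] E →L[ℝ] E) (L : H →L[ℝ] E →L[ℝ] ℝ)
    (ev : E →L[ℝ] ℝ) (e₀ e₁ : E) (u w : H) (lam : ℝ) (s : Set ℝ)
    (hs : ∀ k ∈ s, ‖A (lam • w + k ^ 2 • u)‖ < 1) :
    ContinuousOn (mismatch A L ev e₀ e₁ u w lam) s := by
  have hp : Continuous fun k : ℝ => lam • w + k ^ 2 • u := by fun_prop
  have hψ : ContinuousOn (fun k : ℝ =>
      resolventSolution (A (lam • w + k ^ 2 • u)) (e₀ + k • e₁)) s := by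
    have h1 : ContinuousOn (fun k : ℝ => Ring.inverse (1 - A (lam • w + k ^ 2 • u))) s := by
      intro k hk
      have h2 := NormedRing.inverse_continuousAt (Units.oneSub _ (hs k hk))
      rw [Units.val_oneSub] at h2
      have h3 : Continuous fun k : ℝ => 1 - A (lam • w + k ^ 2 • u) :=
        continuous_const.sub (A.continuous.comp hp)
      exact (ContinuousAt.comp (f := fun k : ℝ => 1 - A (lam • w + k ^ 2 • u)) h2
        h3.continuousAt).continuousWithinAt
    exact h1.clm_apply (by fun_prop)
  have h4 : ContinuousOn (fun k : ℝ => L (lam • w + k ^ 2 • u)) s :=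
    (L.continuous.comp hp).continuousOn
  exact (continuousOn_id.add (h4.clm_apply hψ)).add
    (continuousOn_id.mul (ev.continuous.comp_continuousOn hψ))

theorem exists_mismatch_eq_zero [CompleteSpace E] (A : H →L[ℝ] E →L[ℝ] E) (L : H →L[ℝ] E →L[ℝ] ℝ)
    (ev : E →L[ℝ] ℝ) (e₀ e₁ : E) (hev : ev e₀ = 1) (u v v₁ : H) (w : ℝ → H)
    (hw : (fun lam => w lam - v - lam • v₁) =o[𝓝[≠] (0 : ℝ)] (fun lam : ℝ => lam))
    (hv : L v e₀ = 0) (hv₁ : L v₁ e₀ = 0) {J : ℝ} (hJ : 0 < J) (hJL : L v (A v e₀) = -J) :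
    ∃ k : ℝ → ℝ, (∀ᶠ lam in 𝓝[≠] (0 : ℝ), 0 < k lam ∧ ∃ ψ : E,
        ψ = e₀ + k lam • e₁ + A (lam • w lam + (k lam) ^ 2 • u) ψ ∧
        k lam + L (lam • w lam + (k lam) ^ 2 • u) ψ + k lam * ev ψ = 0) ∧
      Tendsto (fun lam => k lam / lam ^ 2) (𝓝[≠] (0 : ℝ)) (𝓝 (J / 2)) := by
  set l := 𝓝[≠] (0 : ℝ) with hl
  set G : ℝ → ℝ → ℝ := fun lam => mismatch A L ev e₀ e₁ u (w lam) lam with hG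
  have hne : ∀ᶠ lam in l, lam ≠ 0 := self_mem_nhdsWithin
  -- Letting `k` be any function of size `O(lam²)` covers both end points and, later, the root
  -- itself, of which nothing else is known.
  have hasymp : ∀ k : ℝ → ℝ, k =O[l] (fun lam : ℝ => lam ^ 2) →
      (fun lam => G lam (k lam) - 2 * k lam + J * lam ^ 2) =o[l] (fun lam : ℝ => lam ^ 2) := by
    intro k hk
    refine (mismatch_isLittleO A L ev e₀ e₁ hev u v v₁ w hw hv hv₁ k hk).congr_left fun lam => ?_
    rw [hJL]; ring
  have h0 : ∀ᶠ lam in l, G lam 0 < 0 := by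
    have := (hasymp (fun _ => 0) (isBigO_zero _ _)).bound (half_pos hJ)
    filter_upwards [this, hne] with lam h hlam
    have hpos : 0 < lam ^ 2 := by positivity
    rw [Real.norm_eq_abs, Real.norm_eq_abs, abs_of_pos hpos] at h
    nlinarith [(abs_le.mp h).2]
  -- The main part is `-J lam²` at `k = 0` and `+J lam²` at `k = J lam²`, so an error of `(J / 2)
  -- lam²` is harmless at both ends.
  have h1 : ∀ᶠ lam in l, 0 < G lam (J * lam ^ 2) := by
    have := (hasymp (fun lam => J * lam ^ 2) ((isBigO_refl _ _).const_mul_left J)).bound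
      (half_pos hJ)
    filter_upwards [this, hne] with lam h hlam
    have hpos : 0 < lam ^ 2 := by positivity
    rw [Real.norm_eq_abs, Real.norm_eq_abs, abs_of_pos hpos] at h
    nlinarith [(abs_le.mp h).1]
  have hex : ∀ᶠ lam in l, ∃ k, k ∈ Set.Icc 0 (J * lam ^ 2) ∧ G lam k = 0 := by
    filter_upwards [h0, h1, eventually_norm_lt_one A u v v₁ w hw J] with lam h0 h1 hnorm
    have hcont := continuousOn_mismatch A L ev e₀ e₁ u (w lam) lam _ hnorm
    obtain ⟨k, hk, hk'⟩ := intermediate_value_Icc (by positivity) hcont ⟨h0.le, h1.le⟩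
    exact ⟨k, hk, hk'⟩
  obtain ⟨k, hk⟩ := hex.choice
  refine ⟨k, ?_, ?_⟩
  · filter_upwards [hk, h0, eventually_norm_lt_one A u v v₁ w hw J] with lam ⟨hk, hkG⟩ h0 hnorm
    refine ⟨lt_of_le_of_ne hk.1 fun h => ?_, _,
      resolventSolution_eq (Units.oneSub _ (hnorm _ hk)).isUnit _, hkG⟩
    rw [← h] at hkG
    exact h0.ne hkG
  · have hkO : k =O[l] (fun lam : ℝ => lam ^ 2) := by
      refine IsBigO.of_bound J ?_
      filter_upwards [hk] with lam h
      rw [Real.norm_eq_abs, Real.norm_eq_abs, abs_of_nonneg h.1.1, abs_of_nonneg (sq_nonneg _)]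
      exact h.1.2
    -- At the root `G` vanishes, so this says `J - 2 k / lam² → 0`.
    have h2 := (hasymp k hkO).tendsto_div_nhds_zero
    have h3 := (h2.const_sub J).div_const 2
    rw [sub_zero] at h3
    refine h3.congr' ?_
    filter_upwards [hk, hne] with lam h hlam
    rw [h.2]
    field_simp
    ring

end Abstract

/-! ### The Volterra operator on `[-R, R]`, with `L²` potentials and bounded continuous solutions -/

section Concrete

set_option maxSynthPendingDepth 5

open BoundedContinuousFunction

/-- The nearest point projection of the line onto `[-R, R]`. -/
noncomputable def clamp (R x : ℝ) : ℝ := max (-R) (min x R)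

theorem abs_clamp_le (R x : ℝ) : |clamp R x| ≤ |R| := by
  unfold clamp
  grind

theorem clamp_of_mem {R x : ℝ} (hx : x ∈ Set.Icc (-R) R) : clamp R x = x := by
  rw [clamp, min_eq_left hx.2, max_eq_right hx.1]

theorem abs_clamp_sub_le (R x y : ℝ) : |clamp R x - clamp R y| ≤ |x - y| := by
  unfold clamp
  grind

theorem continuous_clamp (R : ℝ) : Continuous (clamp R) := by
  unfold clamp
  fun_prop

/-- Lebesgue measure on `[-R, R]`. -/
noncomputable abbrev intervalMeasure (R : ℝ) : Measure ℝ := volume.restrict (Set.Icc (-R) R)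

/-- The function `x ↦ x + R` on `[-R, R]`, extended to a bounded continuous function. -/
noncomputable def affineBCF (R : ℝ) : ℝ →ᵇ ℝ :=
  .ofNormedAddCommGroup (fun x => clamp R x + R) ((continuous_clamp R).add continuous_const)
    (|R| + |R|) fun x => (norm_add_le _ _).trans (add_le_add (abs_clamp_le R x) le_rfl)

/-- The kernel `t ↦ (x - t)₊` of double integration from `-R`. -/
noncomputable def volterraKernel (R x : ℝ) : ℝ →ᵇ ℝ :=
  .ofNormedAddCommGroup (fun t => max (clamp R x - clamp R t) 0)
    ((continuous_const.sub (continuous_clamp R)).max continuous_const) (2 * |R|) fun t => by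
      have h1 := abs_clamp_le R x
      have h2 := abs_clamp_le R t
      rw [Real.norm_eq_abs]
      grind

theorem norm_volterraKernel_le (R x : ℝ) : ‖volterraKernel R x‖ ≤ 2 * |R| :=
  norm_ofNormedAddCommGroup_le _ (by positivity) _

/-- Continuity in the sup norm makes the image of the Volterra operator continuous in `x`. -/
theorem continuous_volterraKernel (R : ℝ) : Continuous (volterraKernel R) := by
  have : LipschitzWith 1 (volterraKernel R) := by
    refine LipschitzWith.of_dist_le_mul fun x y => ?_
    rw [NNReal.coe_one, one_mul]
    refine (dist_le dist_nonneg).2 fun t => ?_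
    have := abs_clamp_sub_le R x y
    simp only [volterraKernel, coe_ofNormedAddCommGroup, Real.dist_eq]
    refine le_trans ?_ this
    refine (abs_max_sub_max_le_abs _ _ _).trans (le_of_eq ?_)
    congr 1; ring
  exact this.continuous

/-- The integral `∫ p φ` over `[-R, R]`. -/
noncomputable def l2Pairing (R : ℝ) :
    Lp ℝ 2 (intervalMeasure R) →L[ℝ] (ℝ →ᵇ ℝ) →L[ℝ] ℝ :=
  LinearMap.mkContinuous₂
    (LinearMap.mk₂ ℝ (fun (p : Lp ℝ 2 (intervalMeasure R)) φ =>
        inner ℝ p (BoundedContinuousFunction.toLp 2 (intervalMeasure R) ℝ φ))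
      (fun p q φ => inner_add_left _ _ _) (fun c p φ => real_inner_smul_left p _ c)
      (fun p φ χ => by rw [map_add, inner_add_right])
      (fun c p φ => by rw [map_smul, real_inner_smul_right]; rfl))
    ‖BoundedContinuousFunction.toLp (E := ℝ) 2 (intervalMeasure R) ℝ‖ fun p φ => by
      refine (norm_inner_le_norm (𝕜 := ℝ) p
        (BoundedContinuousFunction.toLp 2 (intervalMeasure R) ℝ φ)).trans ?_
      have := (BoundedContinuousFunction.toLp (E := ℝ) 2 (intervalMeasure R) ℝ).le_opNorm φ
      calc _ ≤ ‖p‖ * (_ * ‖φ‖) := mul_le_mul_of_nonneg_left this (norm_nonneg _)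
        _ = _ := by ring

theorem l2Pairing_apply (R : ℝ) (p : Lp ℝ 2 (intervalMeasure R)) (φ : ℝ →ᵇ ℝ) :
    l2Pairing R p φ = ∫ x in Set.Icc (-R) R, p x * φ x := by
  change inner ℝ p (BoundedContinuousFunction.toLp 2 (intervalMeasure R) ℝ φ) = _
  rw [L2.inner_def]
  refine integral_congr_ae ?_
  filter_upwards [φ.coeFn_toLp 2 (intervalMeasure R) ℝ] with x hx
  simp [hx, mul_comm]

/-- The operator `ψ ↦ (x ↦ ∫_{-R}^x (x - t) p(t) ψ(t) dt)`. -/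
noncomputable def volterraOp (R : ℝ) :
    Lp ℝ 2 (intervalMeasure R) →L[ℝ] (ℝ →ᵇ ℝ) →L[ℝ] (ℝ →ᵇ ℝ) :=
  have bound : ∀ (p : Lp ℝ 2 (intervalMeasure R)) (ψ : ℝ →ᵇ ℝ) (x : ℝ),
      ‖l2Pairing R p (volterraKernel R x * ψ)‖ ≤ ‖l2Pairing R‖ * (2 * |R|) * ‖p‖ * ‖ψ‖ :=
    fun p ψ x => by
      calc _ ≤ ‖l2Pairing R‖ * ‖p‖ * ‖volterraKernel R x * ψ‖ := (l2Pairing R).le_opNorm₂ _ _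
        _ ≤ ‖l2Pairing R‖ * ‖p‖ * (2 * |R| * ‖ψ‖) := by
          gcongr
          refine (norm_mul_le _ _).trans ?_
          gcongr
          exact norm_volterraKernel_le R x
        _ = _ := by ring
  LinearMap.mkContinuous₂
    (LinearMap.mk₂ ℝ (fun p ψ => BoundedContinuousFunction.ofNormedAddCommGroup
        (fun x => l2Pairing R p (volterraKernel R x * ψ))
        ((l2Pairing R p).continuous.comp ((continuous_volterraKernel R).mul continuous_const))
        _ (bound p ψ))
      (fun p q ψ => by ext x; simp) (fun c p ψ => by ext x; simp)
      (fun p ψ χ => by ext x; simp [mul_add]) (fun c p ψ => by ext x; simp))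
    (‖l2Pairing R‖ * (2 * |R|)) fun p ψ =>
      norm_ofNormedAddCommGroup_le _ (by positivity) (bound p ψ)

theorem volterraOp_apply (R : ℝ) (p : Lp ℝ 2 (intervalMeasure R)) (ψ : ℝ →ᵇ ℝ) (x : ℝ) :
    volterraOp R p ψ x = ∫ t in Set.Icc (-R) R, p t * (max (clamp R x - clamp R t) 0 * ψ t) := by
  change l2Pairing R p (volterraKernel R x * ψ) = _
  rw [l2Pairing_apply]
  rfl

theorem volterraOp_apply_of_mem {R x : ℝ} (hx : x ∈ Set.Icc (-R) R)
    (p : Lp ℝ 2 (intervalMeasure R)) (ψ : ℝ →ᵇ ℝ) :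
    volterraOp R p ψ x = ∫ t in (-R)..x, (x - t) * (p t * ψ t) := by
  rw [volterraOp_apply, intervalIntegral.integral_of_le hx.1, ← integral_Icc_eq_integral_Ioc]
  rw [← integral_indicator measurableSet_Icc, ← integral_indicator measurableSet_Icc]
  refine integral_congr_ae (Eventually.of_forall fun t => ?_)
  have hx1 := hx.1
  have hx2 := hx.2
  by_cases ht : t ∈ Set.Icc (-R) R
  · simp only [Set.indicator_of_mem ht, clamp_of_mem hx, clamp_of_mem ht]
    by_cases htx : t ≤ x
    · rw [Set.indicator_of_mem (Set.mem_Icc.2 ⟨ht.1, htx⟩), max_eq_left (by linarith)]; ring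
    · rw [Set.indicator_of_notMem (fun h => htx h.2), max_eq_right (by linarith)]; ring
  · have : t ∉ Set.Icc (-R) x := fun h => ht ⟨h.1, h.2.trans hx2⟩
    simp only [Set.indicator_of_notMem ht, Set.indicator_of_notMem this]

end Concrete

/-! ### Integration by parts and weak derivatives -/

section Parts

/-- Integration by parts for primitives of integrable functions. -/
theorem integral_primitive_mul {u v : ℝ → ℝ} {a b : ℝ} (hu : IntervalIntegrable u volume a b)
    (hv : IntervalIntegrable v volume a b) :
    ∫ x in a..b, (∫ t in a..x, u t) * v x
      = (∫ t in a..b, u t) * (∫ t in a..b, v t) - ∫ x in a..b, u x * ∫ t in a..x, v t := by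
  have hU := hu.absolutelyContinuousOnInterval_intervalIntegral (c := a) (by simp)
  have hV := hv.absolutelyContinuousOnInterval_intervalIntegral (c := a) (by simp)
  have h := hU.integral_mul_deriv_eq_deriv_mul hV
  simp only [intervalIntegral.integral_same, mul_zero, sub_zero] at h
  have h1 : ∫ x in a..b, (∫ t in a..x, u t) * v x
      = ∫ x in a..b, (∫ t in a..x, u t) * deriv (fun x => ∫ t in a..x, v t) x := by
    refine intervalIntegral.integral_congr_ae ?_
    filter_upwards [hv.ae_hasDerivAt_integral] with x hx hxm
    rw [(hx (Set.uIoc_subset_uIcc hxm) a (by simp)).deriv]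
  have h2 : ∫ x in a..b, u x * (∫ t in a..x, v t)
      = ∫ x in a..b, deriv (fun x => ∫ t in a..x, u t) x * (∫ t in a..x, v t) := by
    refine intervalIntegral.integral_congr_ae ?_
    filter_upwards [hu.ae_hasDerivAt_integral] with x hx hxm
    rw [(hx (Set.uIoc_subset_uIcc hxm) a (by simp)).deriv]
  rw [h1, h2, h]

/-- Cauchy's formula for the double primitive. -/
theorem integral_sub_mul_eq_integral_integral {u : ℝ → ℝ} {a x : ℝ}
    (hu : IntervalIntegrable u volume a x) :
    ∫ t in a..x, (x - t) * u t = ∫ s in a..x, ∫ t in a..s, u t := by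
  -- The primitive of `1` is `x - a`, so integration by parts exchanges the weight for a second
  -- integration.
  have h := integral_primitive_mul (u := fun _ => 1) intervalIntegrable_const hu
  simp only [intervalIntegral.integral_const, smul_eq_mul, mul_one, one_mul] at h
  have h1 : ∫ t in a..x, (x - t) * u t
      = (∫ t in a..x, (x - a) * u t) - ∫ t in a..x, (t - a) * u t := by
    rw [← intervalIntegral.integral_sub (hu.const_mul _)
      (hu.continuousOn_mul (by fun_prop))]
    refine intervalIntegral.integral_congr fun t _ => ?_
    ring
  rw [h1, intervalIntegral.integral_const_mul, h]
  ring

/-- Both `φ` and `f - f (-M)` are primitives on an interval `[-M, M]` containing the support of `φ`,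
so integration by parts applies without boundary terms. -/
theorem isWeakDeriv_of_eq_integral {f g : ℝ → ℝ} (hg : LocallyIntegrable g volume)
    (hfg : ∀ a b : ℝ, f b - f a = ∫ t in a..b, g t) :
    IsWeakDeriv (fun x => (f x : ℂ)) (fun x => (g x : ℂ)) := by
  intro φ hφ hφc
  have hint : ∀ a b, IntervalIntegrable g volume a b := fun a b =>
    (hg.integrableOn_isCompact isCompact_uIcc).intervalIntegrable
  obtain ⟨N, hN⟩ := hφc.isCompact.isBounded.subset_closedBall 0
  rw [Real.closedBall_eq_Icc, zero_sub, zero_add] at hN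
  -- The extra `1` puts the end points strictly outside the support, so `φ` vanishes there.
  set M := |N| + 1 with hM
  have hNM : -M < -N ∧ N < M := by constructor <;> grind
  have hsupp : ∀ x, x ∉ Set.Ioc (-M) M → φ x = 0 := fun x hx => by
    refine image_eq_zero_of_notMem_tsupport fun h => hx ?_
    exact ⟨hNM.1.trans_le (hN h).1, (hN h).2.trans hNM.2.le⟩
  have hsupp' : ∀ x, x ∉ Set.Ioc (-M) M → deriv φ x = 0 := fun x hx => by
    refine image_eq_zero_of_notMem_tsupport fun h => hx ?_
    have h := hN (tsupport_deriv_subset h)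
    exact ⟨hNM.1.trans_le h.1, h.2.trans hNM.2.le⟩
  have hMM : -M ≤ M := by grind
  have hderiv : Continuous (deriv φ) := hφ.continuous_deriv (by simp)
  have hφI : ∀ x, φ x = ∫ t in (-M)..x, deriv φ t := fun x => by
    rw [intervalIntegral.integral_deriv_eq_sub
      (fun y _ => (hφ.differentiable (by simp)) y) (hderiv.intervalIntegrable _ _),
      hsupp (-M) (by simp), sub_zero]
  have key := integral_primitive_mul (hderiv.intervalIntegrable (-M) M) (hint (-M) M)
  simp only [← hφI] at key
  simp only [← hfg] at key
  have hsm : φ M = 0 := by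
    by_contra h
    have := (hN (subset_tsupport φ h)).2
    linarith [hNM.2]
  have hc : ∫ x in (-M)..M, deriv φ x * (f x - f (-M)) = ∫ x in (-M)..M, deriv φ x * f x := by
    have hfc : Continuous f := by
      have : f = fun x => f 0 + ∫ t in (0 : ℝ)..x, g t := by
        ext x; rw [← hfg]; ring
      rw [this]
      exact continuous_const.add (intervalIntegral.continuous_primitive hint 0)
    simp only [mul_sub]
    have i1 : IntervalIntegrable (fun x => deriv φ x * f x) volume (-M) M :=
      (hderiv.mul hfc).intervalIntegrable _ _
    have i2 : IntervalIntegrable (fun x => deriv φ x * f (-M)) volume (-M) M :=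
      (hderiv.mul continuous_const).intervalIntegrable _ _
    rw [intervalIntegral.integral_sub i1 i2,
      intervalIntegral.integral_mul_const, ← hφI, hsm]
    ring
  rw [hsm, hc, zero_mul, zero_sub] at key
  have e1 : ∫ x, deriv φ x * f x = ∫ x in (-M)..M, deriv φ x * f x := by
    rw [intervalIntegral.integral_of_le hMM, setIntegral_eq_integral_of_forall_compl_eq_zero]
    intro x hx; rw [hsupp' x hx, zero_mul]
  have e2 : ∫ x, φ x * g x = ∫ x in (-M)..M, φ x * g x := by
    rw [intervalIntegral.integral_of_le hMM, setIntegral_eq_integral_of_forall_compl_eq_zero]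
    intro x hx; rw [hsupp x hx, zero_mul]
  simp only [Complex.real_smul, ← Complex.ofReal_mul]
  rw [integral_complex_ofReal, integral_complex_ofReal, e1, e2, key]
  simp

end Parts

/-! ### Gluing the eigenfunction from its three pieces -/

section Eigenfunction

/-- The function `h` on `[-R, R]`, continued by decaying exponentials with values `a`, `b` at the
end points. -/
noncomputable def expGlue (R k a b : ℝ) (h : ℝ → ℝ) (x : ℝ) : ℝ :=
  if x < -R then a * Real.exp (k * (x + R))
  else if x ≤ R then h x else b * Real.exp (-k * (x - R))

variable {R k a b : ℝ} {h G : ℝ → ℝ}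

theorem expGlue_of_lt {x : ℝ} (hx : x < -R) :
    expGlue R k a b h x = a * Real.exp (k * (x + R)) := if_pos hx

theorem expGlue_of_mem {x : ℝ} (hx : x ∈ Set.Icc (-R) R) : expGlue R k a b h x = h x := by
  rw [expGlue, if_neg (not_lt.2 hx.1), if_pos hx.2]

theorem expGlue_of_gt (hR : 0 ≤ R) {x : ℝ} (hx : R < x) :
    expGlue R k a b h x = b * Real.exp (-k * (x - R)) := by
  rw [expGlue, if_neg (by linarith), if_neg (by linarith)]

theorem memLp_expGlue (hR : 0 ≤ R) (hk : 0 < k) (hh : Continuous h) :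
    MemLp (expGlue R k a b h) 2 volume := by
  have hmeas : Measurable (expGlue R k a b h) := by
    refine Measurable.ite measurableSet_Iio (by fun_prop)
      (Measurable.ite measurableSet_Iic hh.measurable (by fun_prop))
  rw [memLp_two_iff_integrable_sq hmeas.aestronglyMeasurable, ← integrableOn_univ]
  have hU : (Set.univ : Set ℝ) = (Set.Iio (-R) ∪ Set.Icc (-R) R) ∪ Set.Ioi R := by
    ext x; simp; grind
  rw [hU]
  refine (IntegrableOn.union ?_ ?_).union ?_
  · have h1 := ((integrableOn_exp_mul_Iic (a := 2 * k) (by positivity) (-R)).mono_set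
      Set.Iio_subset_Iic_self).const_mul (a ^ 2 * Real.exp (2 * k * R))
    refine IntegrableOn.congr_fun h1 (fun x hx => ?_) measurableSet_Iio
    rw [expGlue_of_lt hx, mul_pow, ← Real.exp_nat_mul, mul_assoc, ← Real.exp_add]
    congr 2
    push_cast; ring
  · refine IntegrableOn.congr_fun (f := fun x => h x ^ 2)
      (hh.pow 2).integrableOn_Icc (fun x hx => ?_) measurableSet_Icc
    rw [expGlue_of_mem hx]
  · have h1 := (integrableOn_exp_mul_Ioi (a := -(2 * k)) (by linarith) R).const_mul
      (b ^ 2 * Real.exp (2 * k * R))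
    refine IntegrableOn.congr_fun h1 (fun x hx => ?_) measurableSet_Ioi
    rw [expGlue_of_gt hR hx, mul_pow, ← Real.exp_nat_mul, mul_assoc, ← Real.exp_add]
    congr 2
    push_cast; ring

theorem integral_const_mul_exp (c k s x y : ℝ) :
    ∫ t in x..y, k * c * Real.exp (k * (t + s))
      = c * Real.exp (k * (y + s)) - c * Real.exp (k * (x + s)) := by
  have hc : Continuous fun t => k * c * Real.exp (k * (t + s)) := by fun_prop
  refine intervalIntegral.integral_eq_sub_of_hasDerivAt
    (f := fun t => c * Real.exp (k * (t + s))) (fun t _ => ?_) (hc.intervalIntegrable _ _)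
  have h1 : HasDerivAt (fun t => k * (t + s)) k t := by
    simpa using ((hasDerivAt_id t).add_const s).const_mul k
  exact (h1.exp.const_mul c).congr_deriv (by ring)

/-- Used twice: for the eigenfunction with its derivative, and for that derivative with the second
one. The outer conditions hold only almost everywhere because the potential vanishes only almost
everywhere there. -/
theorem expGlue_sub_eq_integral (hR : 0 ≤ R) (hG : LocallyIntegrable G volume)
    (hb : h R = b)
    (hmid : ∀ x ∈ Set.Icc (-R) R, h x - a = ∫ t in (-R)..x, G t)
    (hl : ∀ᵐ x, x < -R → G x = k * a * Real.exp (k * (x + R)))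
    (hr : ∀ᵐ x, R < x → G x = -k * b * Real.exp (-k * (x - R))) (x y : ℝ) :
    expGlue R k a b h y - expGlue R k a b h x = ∫ t in x..y, G t := by
  have hint : ∀ a b, IntervalIntegrable G volume a b := fun a b =>
    (hG.integrableOn_isCompact isCompact_uIcc).intervalIntegrable
  have key : ∀ x, expGlue R k a b h x - a = ∫ t in (-R)..x, G t := by
    intro x
    rcases lt_or_ge x (-R) with hx | hx
    · have h1 : ∫ t in (-R)..x, G t = ∫ t in (-R)..x, k * a * Real.exp (k * (t + R)) := by
        refine intervalIntegral.integral_congr_ae ?_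
        have hne : ∀ᵐ t : ℝ, t ≠ -R := by simp [ae_iff]
        filter_upwards [hl, hne] with t ht hne htm
        rw [Set.uIoc_of_ge hx.le] at htm
        exact ht (lt_of_le_of_ne htm.2 hne)
      rw [h1, integral_const_mul_exp, expGlue_of_lt hx]
      simp
    rcases le_or_gt x R with hx' | hx'
    · rw [expGlue_of_mem ⟨hx, hx'⟩, hmid x ⟨hx, hx'⟩]
    · have h1 : ∫ t in R..x, G t = ∫ t in R..x, -k * b * Real.exp (-k * (t + -R)) := by
        refine intervalIntegral.integral_congr_ae ?_
        filter_upwards [hr] with t ht htm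
        rw [Set.uIoc_of_le hx'.le] at htm
        exact ht htm.1
      rw [← intervalIntegral.integral_add_adjacent_intervals (hint (-R) R) (hint R x), h1,
        integral_const_mul_exp, ← hmid R ⟨by linarith, le_rfl⟩, expGlue_of_gt hR hx', hb]
      simp [sub_eq_add_neg]
      ring
  rw [← intervalIntegral.integral_interval_sub_left (hint (-R) y) (hint (-R) x), ← key, ← key]
  ring

/-- A solution of the Volterra equation on `[-R, R]` whose continuation by exponentials is
differentiable gives an eigenvalue. -/
theorem isSchrodingerEigenvalue_of_volterra {q ψ : ℝ → ℝ} (hR : 0 ≤ R) (hk : 0 < k)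
    (hq : MemLp q ∞ volume) (hqs : ∀ᵐ x, R < |x| → q x = 0) (hψ : Continuous ψ)
    (hvol : ∀ x ∈ Set.Icc (-R) R,
      ψ x = 1 + k * (x + R) + ∫ t in (-R)..x, (x - t) * ((q t + k ^ 2) * ψ t))
    (hbc : k + (∫ t in (-R)..R, (q t + k ^ 2) * ψ t) + k * ψ R = 0) :
    IsSchrodingerEigenvalue q (-k ^ 2) := by
  have hRR : -R ≤ R := by linarith
  set f : ℝ → ℝ := expGlue R k 1 (ψ R) ψ with hf
  set P : ℝ → ℝ := fun x => q x * f x + k ^ 2 * f x with hP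
  set φ : ℝ → ℝ := fun x => k + ∫ t in (-R)..x, P t with hφ
  set g : ℝ → ℝ := expGlue R k k (-k * ψ R) φ with hg
  have hfL : MemLp f 2 volume := memLp_expGlue hR hk hψ
  have hPL : MemLp P 2 volume := (hfL.mul' hq).add (hfL.const_mul _)
  have hPint : ∀ a b, IntervalIntegrable P volume a b := fun a b =>
    ((hPL.locallyIntegrable one_le_two).integrableOn_isCompact isCompact_uIcc).intervalIntegrable
  have hφc : Continuous φ :=
    continuous_const.add (intervalIntegral.continuous_primitive hPint _)
  have hgL : MemLp g 2 volume := memLp_expGlue hR hk hφc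
  have hPψ : ∀ x ∈ Set.Icc (-R) R, P x = (q x + k ^ 2) * ψ x := fun x hx => by
    simp only [hP, hf, expGlue_of_mem hx]; ring
  have hPψi : ∀ x ∈ Set.Icc (-R) R, ∀ t ∈ Set.uIcc (-R) x, t ∈ Set.Icc (-R) R := by
    intro x hx t ht
    rw [Set.uIcc_of_le hx.1] at ht
    exact ⟨ht.1, ht.2.trans hx.2⟩
  -- The boundary condition `hbc` is exactly continuity of the derivative at `R`.
  have hφR : φ R = -k * ψ R := by
    have : ∫ t in (-R)..R, P t = ∫ t in (-R)..R, (q t + k ^ 2) * ψ t :=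
      intervalIntegral.integral_congr fun t ht => hPψ t (hPψi R ⟨hRR, le_rfl⟩ t ht)
    simp only [hφ, this]
    linarith
  have hgP : ∀ x y, g y - g x = ∫ t in x..y, P t := by
    refine expGlue_sub_eq_integral hR (hPL.locallyIntegrable one_le_two) hφR
      (fun x _ => by simp [hφ]) ?_ ?_
    · filter_upwards [hqs] with x hx hxR
      simp only [hP, hx (by rw [lt_abs]; right; linarith), hf, expGlue_of_lt hxR]
      ring
    · filter_upwards [hqs] with x hx hxR
      simp only [hP, hx (by rw [lt_abs]; left; linarith), hf, expGlue_of_gt hR hxR]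
      ring
  have hfg : ∀ x y, f y - f x = ∫ t in x..y, g t := by
    refine expGlue_sub_eq_integral hR (hgL.locallyIntegrable one_le_two) rfl ?_ ?_ ?_
    · intro x hx
      have h1 : ∫ t in (-R)..x, g t = ∫ t in (-R)..x, φ t :=
        intervalIntegral.integral_congr fun t ht => expGlue_of_mem (hPψi x hx t ht)
      have h2 : ∫ t in (-R)..x, (x - t) * ((q t + k ^ 2) * ψ t)
          = ∫ t in (-R)..x, (x - t) * P t :=
        intervalIntegral.integral_congr fun t ht => by
          simp only [hPψ t (hPψi x hx t ht)]
      rw [h1, hvol x hx, h2, integral_sub_mul_eq_integral_integral (hPint _ _)]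
      simp only [hφ]
      rw [intervalIntegral.integral_add intervalIntegrable_const
        ((intervalIntegral.continuous_primitive hPint _).intervalIntegrable _ _)]
      simp only [intervalIntegral.integral_const, smul_eq_mul]
      ring
    · exact Eventually.of_forall fun x hx => by
        rw [hg, expGlue_of_lt hx, mul_one]
    · exact Eventually.of_forall fun x hx => expGlue_of_gt hR hx
  refine ⟨fun x => (f x : ℂ), fun h0 => ?_, ?_, fun x => (g x : ℂ), fun x => (P x : ℂ),
    ⟨hfL.ofReal, hgL.ofReal, hPL.ofReal,
      isWeakDeriv_of_eq_integral (hgL.locallyIntegrable one_le_two) hfg,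
      isWeakDeriv_of_eq_integral (hPL.locallyIntegrable one_le_two) hgP⟩,
    Eventually.of_forall fun x => ?_⟩
  -- The left exponential never vanishes, and its half-line is not a null set.
  · have hlt : ∀ x ∈ Set.Iio (-R), (f x : ℂ) ≠ 0 := fun x hx => by
      rw [hf, expGlue_of_lt hx, Complex.ofReal_ne_zero]
      positivity
    have hnull : volume (Set.Iio (-R)) = 0 :=
      measure_mono_null (fun x hx => hlt x hx) h0
    simp at hnull
  · exact hfL.ofReal.const_mul _
  · simp only [hP]
    push_cast
    ring

end Eigenfunction

/-! ### Quadratic functionals of a mean-zero potential -/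

section Moments

variable {V : ℝ → ℝ} {R : ℝ}

theorem integral_eq_intervalIntegral_of_support {F : ℝ → ℝ} (hR : 0 ≤ R)
    (hF : ∀ᵐ x, R < |x| → F x = 0) : ∫ x, F x = ∫ x in (-R)..R, F x := by
  rw [intervalIntegral.integral_of_le (by linarith), ← integral_Icc_eq_integral_Ioc,
    ← integral_indicator measurableSet_Icc]
  refine integral_congr_ae ?_
  filter_upwards [hF] with x hx
  by_cases h : x ∈ Set.Icc (-R) R
  · rw [Set.indicator_of_mem h]
  · rw [Set.indicator_of_notMem h, hx]
    rw [lt_abs]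
    by_contra! h'
    exact h ⟨by linarith [h'.2], h'.1⟩

theorem memLp_of_memLp_top_of_support {p : ℝ≥0∞} (hV : MemLp V ∞ volume)
    (hs : ∀ᵐ x, R < |x| → V x = 0) : MemLp V p volume := by
  have h1 : MemLp V p (volume.restrict (Set.Icc (-R) R)) := (hV.restrict _).mono_exponent le_top
  refine ((memLp_indicator_iff_restrict measurableSet_Icc).2 h1).ae_eq ?_
  filter_upwards [hs] with x hx
  by_cases h : x ∈ Set.Icc (-R) R
  · rw [Set.indicator_of_mem h]
  · rw [Set.indicator_of_notMem h, hx]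
    rw [lt_abs]
    by_contra! h'
    exact h ⟨by linarith [h'.2], h'.1⟩

theorem integral_Iic_eq_intervalIntegral (hs : ∀ᵐ x, R < |x| → V x = 0) (hV : Integrable V volume)
    (x : ℝ) : ∫ y in Set.Iic x, V y = ∫ y in (-R)..x, V y := by
  have h0 : ∫ y in Set.Iic (-R), V y = 0 := by
    refine setIntegral_eq_zero_of_ae_eq_zero ?_
    have hne : ∀ᵐ t : ℝ, t ≠ -R := by simp [ae_iff]
    filter_upwards [hs, hne] with y hy hne hym
    exact hy (lt_abs.2 (Or.inr (by linarith [lt_of_le_of_ne hym hne])))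
  rw [← intervalIntegral.integral_Iic_sub_Iic hV.integrableOn hV.integrableOn, h0, sub_zero]

theorem integral_Iic_eq_zero_of_abs_gt (hs : ∀ᵐ x, R < |x| → V x = 0)
    (hV : Integrable V volume) (hmean : ∫ x, V x = 0) {x : ℝ} (hx : R < |x|) :
    ∫ y in Set.Iic x, V y = 0 := by
  rcases lt_abs.1 hx with hx | hx
  · rw [← integral_add_compl (measurableSet_Iic (a := x)) hV] at hmean
    rw [← hmean, left_eq_add]
    refine setIntegral_eq_zero_of_ae_eq_zero ?_
    filter_upwards [hs] with y hy hym
    rw [Set.compl_Iic] at hym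
    exact hy (lt_abs.2 (Or.inl (hx.trans hym)))
  · refine setIntegral_eq_zero_of_ae_eq_zero ?_
    filter_upwards [hs] with y hy hym
    exact hy (lt_abs.2 (Or.inr (by linarith [Set.mem_Iic.1 hym])))

theorem integral_sq_integral_Iic (hR : 0 ≤ R) (hs : ∀ᵐ x, R < |x| → V x = 0)
    (hV : Integrable V volume) (hmean : ∫ x, V x = 0) :
    ∫ x, (∫ y in Set.Iic x, V y) ^ 2 = ∫ x in (-R)..R, (∫ t in (-R)..x, V t) ^ 2 := by
  rw [integral_eq_intervalIntegral_of_support hR (Eventually.of_forall fun x hx => by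
    rw [integral_Iic_eq_zero_of_abs_gt hs hV hmean hx, zero_pow two_ne_zero])]
  simp only [integral_Iic_eq_intervalIntegral hs hV]

/-- By Cauchy's formula the inner integral is a double primitive of `V`; integrating by parts once
more leaves the square, and mean zero removes the boundary term. -/
theorem integral_mul_cauchy (hV : Integrable V volume) (hmean : ∫ x in (-R)..R, V x = 0) :
    ∫ x in (-R)..R, V x * ∫ t in (-R)..x, (x - t) * V t
      = -∫ x in (-R)..R, (∫ t in (-R)..x, V t) ^ 2 := by
  have hint : ∀ a b, IntervalIntegrable V volume a b := fun a b => hV.intervalIntegrable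
  have hF : Continuous fun x => ∫ t in (-R)..x, V t :=
    intervalIntegral.continuous_primitive hint _
  have h := integral_primitive_mul (hF.intervalIntegrable (-R) R) (hint (-R) R)
  rw [hmean, mul_zero, zero_sub] at h
  simp only [integral_sub_mul_eq_integral_integral (hint _ _), sq]
  rw [← h]
  exact intervalIntegral.integral_congr fun x _ => mul_comm _ _

/-- Replacing `|x - y|` by `2 (x - y)₊ - (x - y)` leaves, by mean zero, the constant `∫ t V(t) dt`
in the inner integral; integrating it against `V` gives zero. -/
theorem integral_integral_abs_sub (hR : 0 ≤ R) (hV : Integrable V volume)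
    (hs : ∀ᵐ x, R < |x| → V x = 0) (hmean : ∫ x in (-R)..R, V x = 0) :
    ∫ x, ∫ y, V x * |x - y| * V y
      = 2 * ∫ x in (-R)..R, V x * ∫ t in (-R)..x, (x - t) * V t := by
  have hint : ∀ a b, IntervalIntegrable V volume a b := fun a b => hV.intervalIntegrable
  have hinner : ∀ x ∈ Set.Icc (-R) R, ∫ y, V x * |x - y| * V y
      = 2 * (V x * ∫ t in (-R)..x, (x - t) * V t) + (∫ t in (-R)..R, t * V t) * V x := by
    intro x hx
    have h1 : ∫ y, V x * |x - y| * V y = ∫ y in (-R)..R, V x * |x - y| * V y :=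
      integral_eq_intervalIntegral_of_support hR (by
        filter_upwards [hs] with y hy hyR
        rw [hy hyR, mul_zero])
    have i1 : ∀ a b, IntervalIntegrable (fun y => |x - y| * V y) volume a b := fun a b =>
      (hint a b).continuousOn_mul (by fun_prop)
    have i2 : ∀ a b, IntervalIntegrable (fun y => (x - y) * V y) volume a b := fun a b =>
      (hint a b).continuousOn_mul (by fun_prop)
    have i3 : ∀ a b, IntervalIntegrable (fun y => y * V y) volume a b := fun a b =>
      (hint a b).continuousOn_mul (by fun_prop)
    have e1 : ∫ y in (-R)..x, |x - y| * V y = ∫ y in (-R)..x, (x - y) * V y := by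
      refine intervalIntegral.integral_congr fun y hy => ?_
      rw [Set.uIcc_of_le hx.1] at hy
      simp only [abs_of_nonneg (sub_nonneg.2 hy.2)]
    have e2 : ∫ y in x..R, |x - y| * V y = -∫ y in x..R, (x - y) * V y := by
      rw [← intervalIntegral.integral_neg]
      refine intervalIntegral.integral_congr fun y hy => ?_
      rw [Set.uIcc_of_le hx.2] at hy
      simp only [abs_of_nonpos (sub_nonpos.2 hy.1), neg_mul]
    have e3 : (∫ y in (-R)..x, (x - y) * V y) + ∫ y in x..R, (x - y) * V y
        = -∫ t in (-R)..R, t * V t := by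
      rw [intervalIntegral.integral_add_adjacent_intervals (i2 _ _) (i2 _ _)]
      simp only [sub_mul]
      rw [intervalIntegral.integral_sub ((hint _ _).const_mul _) (i3 _ _),
        intervalIntegral.integral_const_mul, hmean]
      ring
    simp only [mul_assoc] at h1 ⊢
    rw [h1, intervalIntegral.integral_const_mul,
      ← intervalIntegral.integral_add_adjacent_intervals (i1 (-R) x) (i1 x R), e1, e2]
    linear_combination -V x * e3
  have hFc : Continuous fun x => ∫ t in (-R)..x, ∫ s in (-R)..t, V s :=
    intervalIntegral.continuous_primitive
      (fun a b => (intervalIntegral.continuous_primitive hint _).intervalIntegrable a b) _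
  have i4 : IntervalIntegrable (fun x => V x * ∫ t in (-R)..x, (x - t) * V t) volume (-R) R := by
    simp only [integral_sub_mul_eq_integral_integral (hint _ _)]
    exact (hint _ _).mul_continuousOn hFc.continuousOn
  rw [integral_eq_intervalIntegral_of_support hR (F := fun x => ∫ y, V x * |x - y| * V y) (by
    filter_upwards [hs] with x hx hxR
    simp [hx hxR])]
  rw [intervalIntegral.integral_congr (g := fun x =>
      2 * (V x * ∫ t in (-R)..x, (x - t) * V t) + (∫ t in (-R)..R, t * V t) * V x)
      fun x hx => hinner x (by rwa [Set.uIcc_of_le (by linarith)] at hx)]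
  rw [intervalIntegral.integral_add (i4.const_mul _) ((hint _ _).const_mul _),
    intervalIntegral.integral_const_mul, intervalIntegral.integral_const_mul, hmean]
  ring

/-- Otherwise the continuous primitive of `V` vanishes on `[-R, R]`, and Lebesgue differentiation
gives `V = 0` almost everywhere. -/
theorem integral_primitive_sq_pos (hR : 0 ≤ R) (hV : Integrable V volume)
    (hs : ∀ᵐ x, R < |x| → V x = 0) (hne : ¬ V =ᵐ[volume] 0) :
    0 < ∫ x in (-R)..R, (∫ t in (-R)..x, V t) ^ 2 := by
  have hint : ∀ a b, IntervalIntegrable V volume a b := fun a b => hV.intervalIntegrable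
  have hF : Continuous fun x => ∫ t in (-R)..x, V t :=
    intervalIntegral.continuous_primitive hint _
  by_contra hle
  have hRR : -R ≤ R := by linarith
  have hzero : ∀ x ∈ Set.Icc (-R) R, ∫ t in (-R)..x, V t = 0 := by
    intro x hx
    by_contra hx0
    have hlt : -R < R := by
      refine lt_of_le_of_ne hRR fun h => hx0 ?_
      rw [le_antisymm (hx.2.trans h.ge) hx.1, intervalIntegral.integral_same]
    refine hle (intervalIntegral.integral_pos hlt (hF.pow 2).continuousOn
      (fun _ _ => sq_nonneg _) ⟨x, hx, by positivity⟩)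
  refine hne ?_
  have hn1 : ∀ᵐ t : ℝ, t ≠ -R := by simp [ae_iff]
  have hn2 : ∀ᵐ t : ℝ, t ≠ R := by simp [ae_iff]
  filter_upwards [hs, LocallyIntegrable.ae_hasDerivAt_integral hV.locallyIntegrable, hn1, hn2] with x hx hd h1 h2
  by_cases hxR : R < |x|
  · exact hx hxR
  · rw [not_lt, abs_le] at hxR
    have hnhds : Set.Icc (-R) R ∈ 𝓝 x :=
      Icc_mem_nhds (lt_of_le_of_ne hxR.1 h1.symm) (lt_of_le_of_ne hxR.2 h2)
    have h3 : HasDerivAt (fun x => ∫ t in (-R)..x, V t) 0 x :=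
      (hasDerivAt_const x (0 : ℝ)).congr_of_eventuallyEq
        (Filter.eventuallyEq_of_mem hnhds hzero)
    exact (hd (-R)).unique h3

end Moments

/-! ### Passage to `L²` classes and conclusion -/

section Main

open BoundedContinuousFunction

set_option maxSynthPendingDepth 5

theorem setIntegral_congr_of_ae_restrict {R x : ℝ} (hx : x ∈ Set.Icc (-R) R) {p q : ℝ → ℝ}
    (hpq : p =ᵐ[intervalMeasure R] q) (F : ℝ → ℝ → ℝ) :
    ∫ t in (-R)..x, F t (p t) = ∫ t in (-R)..x, F t (q t) := by
  refine intervalIntegral.integral_congr_ae ?_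
  filter_upwards [(ae_restrict_iff' measurableSet_Icc).1 hpq] with t ht htm
  rw [Set.uIoc_of_le hx.1] at htm
  rw [ht ⟨htm.1.le, htm.2.trans hx.2⟩]

theorem l2Pairing_eq_intervalIntegral {R : ℝ} (hR : 0 ≤ R) {p : Lp ℝ 2 (intervalMeasure R)}
    {q : ℝ → ℝ} (hpq : p =ᵐ[intervalMeasure R] q) (φ : ℝ →ᵇ ℝ) :
    l2Pairing R p φ = ∫ t in (-R)..R, q t * φ t := by
  rw [l2Pairing_apply, integral_Icc_eq_integral_Ioc,
    ← intervalIntegral.integral_of_le (by linarith : -R ≤ R)]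
  exact setIntegral_congr_of_ae_restrict ⟨by linarith, le_rfl⟩ hpq fun t y => y * φ t

theorem volterraOp_eq_intervalIntegral {R x : ℝ} (hx : x ∈ Set.Icc (-R) R)
    {p : Lp ℝ 2 (intervalMeasure R)} {q : ℝ → ℝ} (hpq : p =ᵐ[intervalMeasure R] q) (ψ : ℝ →ᵇ ℝ) :
    volterraOp R p ψ x = ∫ t in (-R)..x, (x - t) * (q t * ψ t) := by
  rw [volterraOp_apply_of_mem hx]
  exact setIntegral_congr_of_ae_restrict hx hpq fun t y => (x - t) * (y * ψ t)

/-- An `L²` function on the line, restricted to `[-R, R]`; zero for functions not in `L²`. -/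
noncomputable def restrictL2 (R : ℝ) (f : ℝ → ℝ) : Lp ℝ 2 (intervalMeasure R) :=
  open Classical in if h : MemLp f 2 volume then (h.restrict _).toLp f else 0

theorem coeFn_restrictL2 {R : ℝ} {f : ℝ → ℝ} (hf : MemLp f 2 volume) :
    restrictL2 R f =ᵐ[intervalMeasure R] f := by
  rw [restrictL2, dif_pos hf]
  exact MemLp.coeFn_toLp _

theorem norm_le_eLpNorm_of_ae_eq {R : ℝ} {p : Lp ℝ 2 (intervalMeasure R)} {f : ℝ → ℝ}
    (hf : MemLp f 2 volume) (h : p =ᵐ[intervalMeasure R] f) :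
    ‖p‖ ≤ (eLpNorm f 2 volume).toReal := by
  rw [Lp.norm_def, eLpNorm_congr_ae h]
  exact ENNReal.toReal_mono hf.eLpNorm_ne_top (eLpNorm_restrict_le f 2 volume _)

end Main

theorem corollary3
    (V V₁ : ℝ → ℝ) (W : ℝ → ℝ → ℝ) (R : ℝ)
    -- `V` and `V₁` are bounded and of compact support
    (hV : MemLp V ∞ volume) (hVsupp : ∀ᵐ x, R < |x| → V x = 0)
    (hV₁ : MemLp V₁ ∞ volume) (hV₁supp : ∀ᵐ x, R < |x| → V₁ x = 0)
    -- for small nonzero `lam` so is `W lam`, with supports in a common interval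
    (hW : ∀ᶠ lam in 𝓝[≠] (0 : ℝ), MemLp (W lam) ∞ volume)
    (hWsupp : ∀ᶠ lam in 𝓝[≠] (0 : ℝ), ∀ᵐ x, R < |x| → W lam x = 0)
    -- `‖W lam - V - lam V₁‖ = o(lam)` in `L²(ℝ)` as `lam → 0`
    (hexp : (fun lam : ℝ => (eLpNorm (fun x => W lam x - V x - lam * V₁ x) 2 volume).toReal)
      =o[𝓝[≠] (0 : ℝ)] (fun lam : ℝ => lam))
    (hV₁mean : ∫ x, V₁ x = 0)
    (hVne : ¬ (V =ᵐ[volume] 0)) (hVmean : ∫ x, V x = 0) :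
    ∃ e : ℝ → ℝ,
      (∀ᶠ lam in 𝓝[≠] (0 : ℝ), IsSchrodingerEigenvalue (fun x => lam * W lam x) (e lam)) ∧
      (∃ r : ℝ → ℝ, Tendsto r (𝓝[≠] (0 : ℝ)) (𝓝 0) ∧
        ∀ᶠ lam in 𝓝[≠] (0 : ℝ),
          e lam = -(lam ^ 4 / 16) * ((∫ x, ∫ y, V x * |x - y| * V y) + r lam) ^ 2) ∧
      (∃ s : ℝ → ℝ, Tendsto s (𝓝[≠] (0 : ℝ)) (𝓝 0) ∧
        ∀ᶠ lam in 𝓝[≠] (0 : ℝ),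
          e lam = -(lam ^ 4 / 4) * ((∫ x, (∫ y in Set.Iic x, V y) ^ 2) + s lam) ^ 2) := by
  -- A negative `R` would make `V` vanish almost everywhere.
  have hR : 0 ≤ R := by
    by_contra! hR
    exact hVne (hVsupp.mono fun x hx => hx (hR.trans_le (abs_nonneg x)))
  have hRR : R ∈ Set.Icc (-R) R := ⟨by linarith, le_rfl⟩
  have hV2 : MemLp V 2 volume := memLp_of_memLp_top_of_support hV hVsupp
  have hV₁2 : MemLp V₁ 2 volume := memLp_of_memLp_top_of_support hV₁ hV₁supp
  have hVi : Integrable V volume :=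
    memLp_one_iff_integrable.1 (memLp_of_memLp_top_of_support hV hVsupp)
  have hVmean' : ∫ x in (-R)..R, V x = 0 := by
    rw [← integral_eq_intervalIntegral_of_support hR hVsupp, hVmean]
  set J := ∫ x in (-R)..R, (∫ t in (-R)..x, V t) ^ 2 with hJ
  have hJpos : 0 < J := integral_primitive_sq_pos hR hVi hVsupp hVne
  have hI : ∫ x, ∫ y, V x * |x - y| * V y = -2 * J := by
    rw [integral_integral_abs_sub hR hVi hVsupp hVmean', integral_mul_cauchy hVi hVmean']
    ring
  have hJ' : ∫ x, (∫ y in Set.Iic x, V y) ^ 2 = J :=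
    integral_sq_integral_Iic hR hVsupp hVi hVmean
  set v := restrictL2 R V with hv
  set v₁ := restrictL2 R V₁ with hv₁
  set w : ℝ → Lp ℝ 2 (intervalMeasure R) := fun lam => restrictL2 R (W lam) with hw
  set u : Lp ℝ 2 (intervalMeasure R) := (memLp_const (1 : ℝ)).toLp (fun _ => (1 : ℝ)) with hu
  have hW2 : ∀ᶠ lam in 𝓝[≠] (0 : ℝ), MemLp (W lam) 2 volume := by
    filter_upwards [hW, hWsupp] with lam h1 h2
    exact memLp_of_memLp_top_of_support h1 h2
  have hwo : (fun lam => w lam - v - lam • v₁) =o[𝓝[≠] (0 : ℝ)] (fun lam : ℝ => lam) := by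
    refine IsBigO.trans_isLittleO (IsBigO.of_bound 1 ?_) hexp
    filter_upwards [hW2] with lam hlam
    rw [one_mul, Real.norm_eq_abs, abs_of_nonneg ENNReal.toReal_nonneg]
    refine norm_le_eLpNorm_of_ae_eq ((hlam.sub hV2).sub (hV₁2.const_mul lam)) ?_
    filter_upwards [Lp.coeFn_sub (w lam - v) (lam • v₁), Lp.coeFn_sub (w lam) v,
      Lp.coeFn_smul lam v₁, coeFn_restrictL2 (R := R) hlam, coeFn_restrictL2 (R := R) hV2,
      coeFn_restrictL2 (R := R) hV₁2] with x h1 h2 h3 h4 h5 h6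
    rw [← hv] at h5
    rw [← hv₁] at h6
    change w lam x = W lam x at h4
    rw [h1, Pi.sub_apply, h2, Pi.sub_apply, h3, Pi.smul_apply, smul_eq_mul, h4, h5, h6]
  have hv0 : l2Pairing R v 1 = 0 := by
    rw [l2Pairing_eq_intervalIntegral hR (coeFn_restrictL2 hV2)]
    simpa using hVmean'
  have hv10 : l2Pairing R v₁ 1 = 0 := by
    rw [l2Pairing_eq_intervalIntegral hR (coeFn_restrictL2 hV₁2)]
    simpa [← integral_eq_intervalIntegral_of_support hR hV₁supp] using hV₁mean
  have hvv : l2Pairing R v (volterraOp R v 1) = -J := by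
    rw [l2Pairing_eq_intervalIntegral hR (coeFn_restrictL2 hV2), hJ,
      ← integral_mul_cauchy hVi hVmean']
    refine intervalIntegral.integral_congr fun x hx => ?_
    rw [Set.uIcc_of_le hRR.1] at hx
    rw [volterraOp_eq_intervalIntegral hx (coeFn_restrictL2 hV2)]
    simp
  -- Here `e₀ + k • e₁` is `1 + k (x + R)` on `[-R, R]`, which encodes the data `1`, `k` at `-R`;
  -- `ev` is evaluation at `R`.
  obtain ⟨k, hk, hlim⟩ := exists_mismatch_eq_zero (volterraOp R) (l2Pairing R)
    (BoundedContinuousFunction.evalCLM ℝ R) 1 (affineBCF R) (by simp) u v v₁ w hwo hv0 hv10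
    hJpos hvv
  -- The remainders turn the brackets into `-4 k / lam²` and `2 k / lam²`, so both formulas become
  -- exact; the minus sign is that of the double integral `-2J`.
  refine ⟨fun lam => -(k lam) ^ 2, ?_, ⟨fun lam => -4 * (k lam / lam ^ 2) + 2 * J, ?_, ?_⟩,
    ⟨fun lam => 2 * (k lam / lam ^ 2) - J, ?_, ?_⟩⟩
  · filter_upwards [hk, hW, hWsupp, hW2] with lam ⟨hkpos, ψ, hψ, hbc⟩ hWm hWs hW2
    have hp : (lam • w lam + k lam ^ 2 • u : Lp ℝ 2 (intervalMeasure R)) =ᵐ[intervalMeasure R]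
        fun x => lam * W lam x + k lam ^ 2 := by
      filter_upwards [Lp.coeFn_add (lam • w lam) (k lam ^ 2 • u), Lp.coeFn_smul lam (w lam),
        Lp.coeFn_smul (k lam ^ 2) u, coeFn_restrictL2 (R := R) hW2,
        (memLp_const (μ := intervalMeasure R) (p := 2) (1 : ℝ)).coeFn_toLp] with x h1 h2 h3 h4 h5
      rw [← hu] at h5
      change w lam x = W lam x at h4
      rw [h1, Pi.add_apply, h2, h3, Pi.smul_apply, Pi.smul_apply, smul_eq_mul, smul_eq_mul, h4, h5,
        mul_one]
    refine isSchrodingerEigenvalue_of_volterra hR hkpos (hWm.const_mul lam) ?_ ψ.continuous ?_ ?_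
    · filter_upwards [hWs] with x hx hxR
      rw [hx hxR, mul_zero]
    · intro x hx
      have h := congrArg (fun φ : BoundedContinuousFunction ℝ ℝ => φ x) hψ
      simp only [BoundedContinuousFunction.coe_add, Pi.add_apply,
        volterraOp_eq_intervalIntegral hx hp] at h
      rw [h]
      simp [affineBCF, clamp_of_mem hx]
    · rw [l2Pairing_eq_intervalIntegral hR hp] at hbc
      exact hbc
  · have := (hlim.const_mul (-4)).add_const (2 * J)
    rwa [show -4 * (J / 2) + 2 * J = 0 by ring] at this
  · filter_upwards [self_mem_nhdsWithin] with lam hlam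
    have : lam ≠ 0 := hlam
    rw [hI]
    field_simp
    ring
  · have := (hlim.const_mul 2).sub_const J
    rwa [show 2 * (J / 2) - J = 0 by ring] at this
  · filter_upwards [self_mem_nhdsWithin] with lam hlam
    have : lam ≠ 0 := hlam
    rw [hJ']
    field_simp
    ring
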